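/- Conventions. A Frobenius 3-fold is a 3-dimensional complex analytic manifold $M$ with holomorphic data: a commutative associative multiplication on each $T_pM$; a non-degenerate flat symmetric inner product $\langle\cdot,\cdot\rangle$ with $\langle u\cdot v,w\rangle=\langle u,v\cdot w\rangle$ and Levi-Civita connection $\nabla$; a unity vector field $e$ with $\nabla e=0$; an Euler vector field $E$ with $\nabla(\nabla E)=0$ whose flow rescales the multiplication and the inner product, i.e. $L_E(\cdot)=k\,(\cdot)$ and $L_E\langle\cdot,\cdot\rangle=d\,\langle\cdot,\cdot\rangle$ for constants $k,d\in\mathbb C$; and such that the 4-tensor $(\nabla_z c)(u,v,w)$, $c(u,v,w)=\langle u\cdot v,w\rangle$, is symmetric in $u,v,w,z$. It is massive if $T_pM$ is semisimple, i.e. is spanned by three idempotents $e_i$ with $e_i\cdot e_j=\delta_{ij}e_i$, for all $p$ in some non-empty open set. On a surface $\Sigma\subset M$ transverse to $e$, the booklet web is the $3$-web whose directions at $p\in\Sigma$ with $T_pM$ semisimple are cut on $T_p\Sigma$ by the three planes spanned by $\{e,e_i\}$; at the other points its directions are the limits of these. The solution web of $p^3+Sp^2+Ap+B=0$, $p=dy/dx$,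 has at $(x,y)$ the directions spanned by $\partial_x+p\,\partial_y$, $p$ a root; a point is regular if the three directions are pairwise distinct. A vector field $X$ is an infinitesimal symmetry of a web if near regular points it preserves each web foliation, i.e. $[X,v]$ is proportional to $v$ for each local nowhere vanishing holomorphic vector field $v$ tangent to the web. Lemma. Let $S,A,B$ be holomorphic functions on a neighbourhood of a point $q_0\in\mathbb C^2$ such that regular points of the solution web of $$p^3+S(x,y)p^2+A(x,y)p+B(x,y)=0,\qquad p=\frac{dy}{dx},$$ occur arbitrarily close to $q_0$ (i.e. the discriminant does not vanish identically near $q_0$). Suppose that 1) the solution web admits an infinitesimal symmetry $X=w_x x\,\partial_x+w_y y\,\partial_y$, where $w_x,w_y\in\mathbb C$ are constants with $w_x\neq w_y$; 2) the coefficients satisfy $$S_x=\tfrac12A_y,\qquad A_x=2B_y,\qquad B_x=SB_y+BS_y-\tfrac12AA_y .$$ Then there is a germ of a massive Frobenius 3-fold $M$ with $\langle e,e\rangle=0$ whose booklet web is the solution web near $q_0$. That is, there are such a Frobenius 3-fold $M$, a neighbourhood $U'$ of $q_0$ and an injective holomorphic immersion $\sigma:U'\to M$ onto a surface transverse to $e$,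 such that for every $q\in U'$ the algebra $T_{\sigma(q)}M$ is semisimple if and only if $q$ is a regular point of the solution web, and $d\sigma_q$ carries the directions of the solution web at $q$ to those of the booklet web at $\sigma(q)$ (at all points, those at singular points being limits). Moreover, $M$ and $\sigma$ can be chosen so that the Euler field $E$ projects to $X$ along $e$: $E(\sigma(q))-d\sigma_q(X(q))\in\mathbb C\,e(\sigma(q))$ for all $q\in U'$. -/

import Mathlib

open Topology Filter

noncomputable section

/-! ### Frobenius structures on open subsets of a complex vector space

Vector fields and tensor fields on an open set `M` of `V` are written in the linear coordinates
of `V`; an affine connection is given by its Christoffel symbols `Γ`, so that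
`∇_u Y = ∂_u Y + Γ(u, Y)`. -/

section Frobenius

variable {V : Type*} [NormedAddCommGroup V] [NormedSpace ℂ V]

/-- The covariant derivative `∇_u Y` of the vector field `Y` at `p`. -/
def covDeriv (Γ : V → V →L[ℂ] V →L[ℂ] V) (Y : V → V) (p u : V) : V :=
  fderiv ℂ Y p u + Γ p u (Y p)

/-- The second covariant derivative `(∇_u (∇ Y))(v)` of the vector field `Y` at `p`. -/
def covDeriv₂ (Γ : V → V →L[ℂ] V →L[ℂ] V) (Y : V → V) (p u v : V) : V :=
  fderiv ℂ (fun x => covDeriv Γ Y x v) p u + Γ p u (covDeriv Γ Y p v)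
    - covDeriv Γ Y p (Γ p u v)

/-- The curvature `R(u, v) w` of the connection at `p`. -/
def curvature (Γ : V → V →L[ℂ] V →L[ℂ] V) (p u v w : V) : V :=
  fderiv ℂ (fun x => Γ x v w) p u - fderiv ℂ (fun x => Γ x u w) p v
    + Γ p u (Γ p v w) - Γ p v (Γ p u w)

/-- The covariant derivative `(∇_z c)(u, v, w)` of a covariant 3-tensor field `c` at `p`. -/
def covDerivTensor (Γ : V → V →L[ℂ] V →L[ℂ] V) (c : V → V → V → V → ℂ) (p z u v w : V) : ℂ :=
  fderiv ℂ (fun x => c x u v w) p z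
    - c p (Γ p z u) v w - c p u (Γ p z v) w - c p u v (Γ p z w)

/-- The Lie derivative `(L_E g)(u, v)` of a bilinear form field at `p`. -/
def lieDerivForm (E : V → V) (g : V → V →L[ℂ] V →L[ℂ] ℂ) (p u v : V) : ℂ :=
  fderiv ℂ (fun x => g x u v) p (E p) + g p (fderiv ℂ E p u) v + g p u (fderiv ℂ E p v)

/-- The Lie derivative `(L_E m)(u, v)` of a field of multiplications at `p`. -/
def lieDerivMul (E : V → V) (m : V → V →L[ℂ] V →L[ℂ] V) (p u v : V) : V :=
  fderiv ℂ (fun x => m x u v) p (E p) - fderiv ℂ E p (m p u v)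
    + m p (fderiv ℂ E p u) v + m p u (fderiv ℂ E p v)

/-- `Γ` is the Levi-Civita connection of `g` on `M`: it is torsion free and `∇ g = 0`.  (For a
non-degenerate symmetric `g` these conditions determine `Γ` on `M`.) -/
structure IsLeviCivita (M : Set V) (g : V → V →L[ℂ] V →L[ℂ] ℂ)
    (Γ : V → V →L[ℂ] V →L[ℂ] V) : Prop where
  torsion_free : ∀ p ∈ M, ∀ u v, Γ p u v = Γ p v u
  metric_parallel : ∀ p ∈ M, ∀ z u v,
    fderiv ℂ (fun x => g x u v) p z = g p (Γ p z u) v + g p u (Γ p z v)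

/-- A Frobenius manifold structure on the open set `M ⊆ V`. -/
structure FrobeniusStructure (M : Set V) where
  isOpen : IsOpen M
  /-- the multiplication on the tangent spaces -/
  mul : V → V →L[ℂ] V →L[ℂ] V
  /-- the inner product -/
  metric : V → V →L[ℂ] V →L[ℂ] ℂ
  /-- the Christoffel symbols of the Levi-Civita connection of the inner product -/
  conn : V → V →L[ℂ] V →L[ℂ] V
  /-- the unity vector field `e` -/
  unit : V → V
  /-- the Euler vector field `E` -/
  euler : V → V
  mul_analytic : AnalyticOnNhd ℂ mul M
  metric_analytic : AnalyticOnNhd ℂ metric M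
  conn_analytic : AnalyticOnNhd ℂ conn M
  unit_analytic : AnalyticOnNhd ℂ unit M
  euler_analytic : AnalyticOnNhd ℂ euler M
  mul_comm : ∀ p ∈ M, ∀ u v, mul p u v = mul p v u
  mul_assoc : ∀ p ∈ M, ∀ u v w, mul p (mul p u v) w = mul p u (mul p v w)
  metric_symm : ∀ p ∈ M, ∀ u v, metric p u v = metric p v u
  metric_nondegenerate : ∀ p ∈ M, ∀ u, (∀ v, metric p u v = 0) → u = 0
  metric_invariant : ∀ p ∈ M, ∀ u v w, metric p (mul p u v) w = metric p u (mul p v w)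
  conn_leviCivita : IsLeviCivita M metric conn
  flat : ∀ p ∈ M, ∀ u v w, curvature conn p u v w = 0
  unit_mul : ∀ p ∈ M, ∀ v, mul p (unit p) v = v
  unit_parallel : ∀ p ∈ M, ∀ u, covDeriv conn unit p u = 0
  euler_linear : ∀ p ∈ M, ∀ u v, covDeriv₂ conn euler p u v = 0
  euler_rescales_mul : ∃ k : ℂ, ∀ p ∈ M, ∀ u v, lieDerivMul euler mul p u v = k • mul p u v
  euler_rescales_metric : ∃ d : ℂ, ∀ p ∈ M, ∀ u v,
    lieDerivForm euler metric p u v = d * metric p u v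
  /-- `(∇_z c)(u, v, w)`, where `c(u, v, w) = ⟨u · v, w⟩`, is symmetric in `z, u, v, w`. -/
  potential : ∀ p ∈ M, ∀ z u v w,
    covDerivTensor conn (fun x a b c => metric x (mul x a b) c) p z u v w
        = covDerivTensor conn (fun x a b c => metric x (mul x a b) c) p u z v w ∧
    covDerivTensor conn (fun x a b c => metric x (mul x a b) c) p z u v w
        = covDerivTensor conn (fun x a b c => metric x (mul x a b) c) p z v u w ∧
    covDerivTensor conn (fun x a b c => metric x (mul x a b) c) p z u v w
        = covDerivTensor conn (fun x a b c => metric x (mul x a b) c) p z u w v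

end Frobenius

/-! ### Webs of curves in the plane with coordinates `(x, y)` -/

/-- A web in the plane, given by the set of its directions (lines through the origin of the
tangent plane `ℂ × ℂ`) at each point. -/
abbrev PlaneWeb := ℂ × ℂ → Set (Submodule ℂ (ℂ × ℂ))

/-- A point is regular for a 3-web if there are three pairwise distinct web directions at it. -/
def IsRegularPoint (W : PlaneWeb) (q : ℂ × ℂ) : Prop :=
  (W q).ncard = 3

/-- The solution web of the implicit ODE `p³ + S p² + A p + B = 0`, `p = dy/dx`: its directions at
`q` are the lines spanned by `∂_x + p ∂_y`, where `p` runs through the roots. -/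
def solutionWeb (S A B : ℂ × ℂ → ℂ) : PlaneWeb := fun q =>
  {l | ∃ p : ℂ, p ^ 3 + S q * p ^ 2 + A q * p + B q = 0 ∧ l = Submodule.span ℂ {((1 : ℂ), p)}}

/-- `X` is an infinitesimal symmetry of the web `W` on `U`: near regular points it preserves each
of the web foliations, i.e. `[X, v]` is proportional to `v` for every local holomorphic nowhere
vanishing vector field `v` tangent to the web. -/
def IsInfinitesimalSymmetry (W : PlaneWeb) (U : Set (ℂ × ℂ)) (X : ℂ × ℂ → ℂ × ℂ) : Prop :=
  ∀ N ⊆ U, IsOpen N → (∀ q ∈ N, IsRegularPoint W q) →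
    ∀ v : ℂ × ℂ → ℂ × ℂ, DifferentiableOn ℂ v N →
      (∀ q ∈ N, v q ≠ 0 ∧ Submodule.span ℂ {v q} ∈ W q) →
        ∀ q ∈ N, VectorField.lieBracket ℂ X v q ∈ Submodule.span ℂ {v q}

/-- The vector field `w_x x ∂_x + w_y y ∂_y`. -/
def weightedField (wx wy : ℂ) : ℂ × ℂ → ℂ × ℂ := fun q => (wx * q.1, wy * q.2)

/-- The partial derivative with respect to `x`. -/
def dx (f : ℂ × ℂ → ℂ) (q : ℂ × ℂ) : ℂ := fderiv ℂ f q (1, 0)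

/-- The partial derivative with respect to `y`. -/
def dy (f : ℂ × ℂ → ℂ) (q : ℂ × ℂ) : ℂ := fderiv ℂ f q (0, 1)

/-- The system `S_x = A_y / 2`, `A_x = 2 B_y`, `B_x = S B_y + B S_y - A A_y / 2` on `U`. -/
def HydrodynamicSystem (U : Set (ℂ × ℂ)) (S A B : ℂ × ℂ → ℂ) : Prop :=
  ∀ q ∈ U,
    dx S q = dy A q / 2 ∧
    dx A q = 2 * dy B q ∧
    dx B q = S q * dy B q + B q * dy S q - A q * dy A q / 2

/-! ### Booklet webs of Frobenius 3-folds -/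

namespace FrobeniusStructure

variable {M : Set (Fin 3 → ℂ)}

/-- `ε 0, ε 1, ε 2` are idempotents splitting the tangent algebra at `p` into the direct product of
three one-dimensional algebras. -/
def IsIdempotentFrame (F : FrobeniusStructure M) (p : Fin 3 → ℂ) (ε : Fin 3 → Fin 3 → ℂ) : Prop :=
  LinearIndependent ℂ ε ∧ ∀ i j, F.mul p (ε i) (ε j) = if i = j then ε i else 0

/-- The tangent algebra at `p` is semisimple. -/
def IsSemisimpleAt (F : FrobeniusStructure M) (p : Fin 3 → ℂ) : Prop :=
  ∃ ε, F.IsIdempotentFrame p ε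

/-- A Frobenius 3-fold is massive if its tangent algebras are semisimple on some (non-empty) open
subset. -/
def IsMassive (F : FrobeniusStructure M) : Prop :=
  ∃ N ⊆ M, IsOpen N ∧ N.Nonempty ∧ ∀ p ∈ N, F.IsSemisimpleAt p

/-- `σ` parametrizes, by the plane domain `U`, a surface in `M` transverse to the unity vector
field. -/
structure IsTransverseSurface (F : FrobeniusStructure M) (U : Set (ℂ × ℂ))
    (σ : ℂ × ℂ → Fin 3 → ℂ) : Prop where
  analytic : AnalyticOnNhd ℂ σ U
  mapsTo : Set.MapsTo σ U M
  injOn : Set.InjOn σ U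
  immersion : ∀ q ∈ U, Function.Injective (fderiv ℂ σ q)
  transverse : ∀ q ∈ U, F.unit (σ q) ∉ Set.range (fderiv ℂ σ q)

/-- The directions which the three planes spanned by the unity `e` and the idempotents `e_i` cut
on the tangent plane of the surface parametrized by `σ` (there are none if the tangent algebra is
not semisimple). -/
def bookletDirections (F : FrobeniusStructure M) (σ : ℂ × ℂ → Fin 3 → ℂ) : PlaneWeb := fun q =>
  {l | ∃ ε, F.IsIdempotentFrame (σ q) ε ∧
    ∃ i, l = (Submodule.span ℂ {F.unit (σ q), ε i}).comap (fderiv ℂ σ q).toLinearMap}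

/-- In the coordinates given by `σ`, the booklet web on the surface is the web `W` on `U`: the
regular points of `W` are those where the tangent algebra is semisimple, there the directions of
the two webs agree, and at every point of `U` the directions of `W` are the limits of the
directions of the booklet web at semisimple points. -/
def IsBookletWeb (F : FrobeniusStructure M) (U : Set (ℂ × ℂ)) (σ : ℂ × ℂ → Fin 3 → ℂ)
    (W : PlaneWeb) : Prop :=
  ∀ q ∈ U, (IsRegularPoint W q ↔ F.IsSemisimpleAt (σ q)) ∧
    (IsRegularPoint W q → F.bookletDirections σ q = W q) ∧
    ∀ v : ℂ × ℂ, v ≠ 0 → (Submodule.span ℂ {v} ∈ W q ↔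
      (q, v) ∈ closure {z : (ℂ × ℂ) × (ℂ × ℂ) |
        z.1 ∈ U ∧ z.2 ≠ 0 ∧ Submodule.span ℂ {z.2} ∈ F.bookletDirections σ z.1})

end FrobeniusStructure

end

/-! Take flat coordinates `t₀, t₁, t₂` with antidiagonal metric, unity `∂/∂t₀`, `x = t₂`, `y = t₁`,
and read the coefficients as third derivatives of a potential `t₀² t₂ / 2 + t₀ t₁² / 2 + f(t₁, t₂)`:
`f₁₁₁ = -S`, `f₁₁₂ = -A/2`, `f₁₂₂ = -B`, `f₂₂₂ = A²/4 - S B`. The choice of `f₂₂₂` is exactly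
associativity, and the three differential equations are exactly the compatibility of these third
derivatives, that is, symmetry of `∇c`. The potential itself is never integrated.

The tangent algebra at a point is `ℂ[z]/(z³ + S z² + A z + B)` in the basis `1, z, z² + S z + A/2`.
The idempotent attached to a root `p` is a multiple of `(z - q)(z - r)`, whose last two coordinates
are proportional to `(p, 1)`. Modulo the unity it points along `∂_x + p ∂_y`, so the booklet web on
`t₀ = 0` is the solution web (`booklet_eq_roots`), and semisimplicity means nonzero discriminant
(`isSemisimple_iff_disc`).

The symmetry scales each root with weight `wy - wx`, hence `S, A, B` with one, two and three times
that weight (`coeffs_weighted`); this makes a diagonal linear field an Euler field. Statements about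
singular points follow by continuity from density of the regular ones. -/

/-! ### Monic cubics: roots, discriminant, perturbation of roots. -/

/-- The value at `p` of the monic cubic with coefficients `s, a, b`. -/
def cubicEval (s a b p : ℂ) : ℂ := p ^ 3 + s * p ^ 2 + a * p + b

/-- The discriminant of the monic cubic with coefficients `s, a, b`. -/
def cubicDisc (s a b : ℂ) : ℂ :=
  18 * s * a * b - 4 * s ^ 3 * b + s ^ 2 * a ^ 2 - 4 * a ^ 3 - 27 * b ^ 2

/-- A quadratic polynomial vanishing at three distinct points is zero. -/
theorem quadratic_coeffs_eq_zero {u v w p q r : ℂ} (hpq : p ≠ q) (hpr : p ≠ r) (hqr : q ≠ r)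
    (hp : u * p ^ 2 + v * p + w = 0) (hq : u * q ^ 2 + v * q + w = 0)
    (hr : u * r ^ 2 + v * r + w = 0) : u = 0 ∧ v = 0 ∧ w = 0 := by
  have h1 : u * (p + q) + v = 0 := by
    apply mul_left_cancel₀ (sub_ne_zero.2 hpq); linear_combination hp - hq
  have h2 : u * (p + r) + v = 0 := by
    apply mul_left_cancel₀ (sub_ne_zero.2 hpr); linear_combination hp - hr
  have hu : u = 0 := by
    apply mul_left_cancel₀ (sub_ne_zero.2 hqr); linear_combination h1 - h2
  subst hu
  have hv : v = 0 := by linear_combination h1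
  subst hv
  exact ⟨rfl, rfl, by linear_combination hp⟩

theorem cubic_vieta {s a b p q r : ℂ} (hpq : p ≠ q) (hpr : p ≠ r) (hqr : q ≠ r)
    (hp : cubicEval s a b p = 0) (hq : cubicEval s a b q = 0) (hr : cubicEval s a b r = 0) :
    s = -(p + q + r) ∧ a = p * q + p * r + q * r ∧ b = -(p * q * r) := by
  unfold cubicEval at *
  obtain ⟨h1, h2, h3⟩ := quadratic_coeffs_eq_zero (u := s + (p + q + r))
    (v := a - (p * q + p * r + q * r)) (w := b + p * q * r) hpq hpr hqr
    (by linear_combination hp) (by linear_combination hq) (by linear_combination hr)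
  exact ⟨by linear_combination h1, by linear_combination h2, by linear_combination h3⟩

theorem exists_cubic_roots (s a b : ℂ) : ∃ p q r : ℂ,
    s = -(p + q + r) ∧ a = p * q + p * r + q * r ∧ b = -(p * q * r) := by
  obtain ⟨p, hp⟩ : ∃ p : ℂ, cubicEval s a b p = 0 := by
    obtain ⟨p, hp⟩ := IsAlgClosed.exists_root (Cubic.mk 1 s a b).toPoly
      (by rw [Cubic.degree_of_a_ne_zero (by simp)]; norm_num)
    refine ⟨p, ?_⟩
    simpa [Cubic.toPoly, cubicEval] using hp
  -- `t` is a square root of the discriminant of the quadratic left after dividing the cubic by `z -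
  -- p`.
  obtain ⟨t, ht⟩ := IsAlgClosed.exists_pow_nat_eq
    ((s + p) ^ 2 - 4 * (a + p * s + p ^ 2)) (n := 2) (by norm_num)
  refine ⟨p, (-(s + p) + t) / 2, (-(s + p) - t) / 2, by ring, by linear_combination ht / 4, ?_⟩
  unfold cubicEval at hp
  linear_combination hp - p / 4 * ht

theorem cubicDisc_vieta (p q r : ℂ) :
    cubicDisc (-(p + q + r)) (p * q + p * r + q * r) (-(p * q * r))
      = ((p - q) * (p - r) * (q - r)) ^ 2 := by
  unfold cubicDisc; ring

/-- Three distinct roots of a monic cubic. -/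
structure CubicRoots (s a b p q r : ℂ) : Prop where
  ne₁₂ : p ≠ q
  ne₁₃ : p ≠ r
  ne₂₃ : q ≠ r
  root₁ : cubicEval s a b p = 0
  root₂ : cubicEval s a b q = 0
  root₃ : cubicEval s a b r = 0

theorem exists_cubicRoots_iff {s a b : ℂ} :
    (∃ p q r, CubicRoots s a b p q r) ↔ cubicDisc s a b ≠ 0 := by
  constructor
  · rintro ⟨p, q, r, h⟩
    obtain ⟨rfl, rfl, rfl⟩ := cubic_vieta h.ne₁₂ h.ne₁₃ h.ne₂₃ h.root₁ h.root₂ h.root₃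
    rw [cubicDisc_vieta]
    exact pow_ne_zero _ (mul_ne_zero (mul_ne_zero (sub_ne_zero.2 h.ne₁₂) (sub_ne_zero.2 h.ne₁₃))
      (sub_ne_zero.2 h.ne₂₃))
  · intro h
    obtain ⟨p, q, r, rfl, rfl, rfl⟩ := exists_cubic_roots s a b
    rw [cubicDisc_vieta] at h
    refine ⟨p, q, r, ?_, ?_, ?_, ?_, ?_, ?_⟩
    · rintro rfl; simp at h
    · rintro rfl; simp at h
    · rintro rfl; simp at h
    all_goals (unfold cubicEval; ring)

/-- Near any point there is a root of the cubic, as close as the value of the cubic is small. -/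
theorem exists_root_near {s a b p : ℂ} : ∃ r, cubicEval s a b r = 0 ∧
    ‖p - r‖ ^ 3 ≤ ‖cubicEval s a b p‖ := by
  obtain ⟨u, v, w, rfl, rfl, rfl⟩ := exists_cubic_roots s a b
  have key : ‖cubicEval (-(u + v + w)) (u * v + u * w + v * w) (-(u * v * w)) p‖
      = ‖p - u‖ * ‖p - v‖ * ‖p - w‖ := by
    rw [← norm_mul, ← norm_mul]; congr 1; unfold cubicEval; ring
  rw [key]
  -- The value of the cubic is the product of the distances to its roots, so the nearest root
  -- satisfies the cubic bound.
  obtain ⟨r, hr, h1, h2, h3⟩ : ∃ r, (r = u ∨ r = v ∨ r = w) ∧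
      ‖p - r‖ ≤ ‖p - u‖ ∧ ‖p - r‖ ≤ ‖p - v‖ ∧ ‖p - r‖ ≤ ‖p - w‖ := by
    rcases le_total ‖p - u‖ ‖p - v‖ with h | h <;> rcases le_total ‖p - v‖ ‖p - w‖ with h' | h' <;>
      rcases le_total ‖p - u‖ ‖p - w‖ with h'' | h''
    all_goals first
      | exact ⟨u, by simp, le_rfl, by assumption, by assumption⟩
      | exact ⟨v, by simp, by assumption, le_rfl, by assumption⟩
      | exact ⟨w, by simp, by assumption, by assumption, le_rfl⟩
      | exact ⟨u, by simp, le_rfl, by linarith, by linarith⟩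
  refine ⟨r, ?_, ?_⟩
  · rcases hr with rfl | rfl | rfl <;> (unfold cubicEval; ring)
  · calc ‖p - r‖ ^ 3 = ‖p - r‖ * ‖p - r‖ * ‖p - r‖ := by ring
      _ ≤ _ := by gcongr

/-! ### The solution web in terms of the cubic. -/

theorem span_one_injective : Function.Injective
    (fun p : ℂ => Submodule.span ℂ {((1 : ℂ), p)}) := by
  intro p q h
  have : ((1 : ℂ), p) ∈ Submodule.span ℂ {((1 : ℂ), q)} := by
    have h' : Submodule.span ℂ {((1 : ℂ), p)} = Submodule.span ℂ {((1 : ℂ), q)} := h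
    rw [← h']; exact Submodule.mem_span_singleton_self _
  obtain ⟨c, hc⟩ := Submodule.mem_span_singleton.1 this
  simp only [Prod.smul_mk, smul_eq_mul, mul_one, Prod.mk.injEq] at hc
  rw [← hc.2, hc.1, one_mul]

theorem isRegularPoint_solutionWeb_iff {S A B : ℂ × ℂ → ℂ} {q : ℂ × ℂ} :
    IsRegularPoint (solutionWeb S A B) q ↔ ∃ p₁ p₂ p₃, CubicRoots (S q) (A q) (B q) p₁ p₂ p₃ := by
  have himg : solutionWeb S A B q = (fun p : ℂ => Submodule.span ℂ {((1 : ℂ), p)}) ''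
      {p | cubicEval (S q) (A q) (B q) p = 0} := by
    ext l
    constructor
    · rintro ⟨p, hp, rfl⟩; exact ⟨p, hp, rfl⟩
    · rintro ⟨p, hp, rfl⟩; exact ⟨p, hp, rfl⟩
  unfold IsRegularPoint
  rw [himg, Set.ncard_image_of_injective _ span_one_injective, Set.ncard_eq_three]
  constructor
  · rintro ⟨x, y, z, hxy, hxz, hyz, h⟩
    refine ⟨x, y, z, hxy, hxz, hyz, ?_, ?_, ?_⟩
    · have : x ∈ ({x, y, z} : Set ℂ) := by simp
      rwa [← h] at this
    · have : y ∈ ({x, y, z} : Set ℂ) := by simp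
      rwa [← h] at this
    · have : z ∈ ({x, y, z} : Set ℂ) := by simp
      rwa [← h] at this
  · rintro ⟨x, y, z, h⟩
    refine ⟨x, y, z, h.ne₁₂, h.ne₁₃, h.ne₂₃, ?_⟩
    obtain ⟨hs, ha, hb⟩ := cubic_vieta h.ne₁₂ h.ne₁₃ h.ne₂₃ h.root₁ h.root₂ h.root₃
    ext p
    have : cubicEval (S q) (A q) (B q) p = (p - x) * ((p - y) * (p - z)) := by
      rw [hs, ha, hb]; unfold cubicEval; ring
    simp only [Set.mem_ofPred_eq, this, mul_eq_zero, sub_eq_zero, Set.mem_insert_iff,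
      Set.mem_singleton_iff]

theorem isRegularPoint_solutionWeb_iff_disc {S A B : ℂ × ℂ → ℂ} {q : ℂ × ℂ} :
    IsRegularPoint (solutionWeb S A B) q ↔ cubicDisc (S q) (A q) (B q) ≠ 0 := by
  rw [isRegularPoint_solutionWeb_iff, exists_cubicRoots_iff]

/-- The homogeneous form has no division by `v.1`, so it is continuous in `(q, v)` and suits passage
to limits. Monicity excludes the vertical direction. -/
theorem span_mem_solutionWeb_iff {S A B : ℂ × ℂ → ℂ} {q v : ℂ × ℂ} (hv : v ≠ 0) :
    Submodule.span ℂ {v} ∈ solutionWeb S A B q ↔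
      v.2 ^ 3 + S q * v.2 ^ 2 * v.1 + A q * v.2 * v.1 ^ 2 + B q * v.1 ^ 3 = 0 := by
  constructor
  · rintro ⟨p, hp, hl⟩
    have : v ∈ Submodule.span ℂ {((1 : ℂ), p)} := by
      rw [← hl]; exact Submodule.mem_span_singleton_self _
    obtain ⟨c, rfl⟩ := Submodule.mem_span_singleton.1 this
    simp only [Prod.smul_mk, smul_eq_mul, mul_one]
    linear_combination c ^ 3 * hp
  · intro h
    have h1 : v.1 ≠ 0 := by
      intro h1
      apply hv
      rw [h1] at h
      have h2 : v.2 = 0 := by simpa using h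
      exact Prod.ext h1 h2
    refine ⟨v.2 / v.1, ?_, ?_⟩
    · field_simp; linear_combination h
    · have : v = v.1 • ((1 : ℂ), v.2 / v.1) := by
        ext <;> simp [mul_div_cancel₀, h1]
      conv_lhs => rw [this]
      exact Submodule.span_singleton_smul_eq (IsUnit.mk0 _ h1) _

/-! ### From the infinitesimal symmetry to weighted homogeneity of the coefficients. -/

/-- A simple root of a monic cubic with holomorphic coefficients extends to a holomorphic family
of roots. -/
theorem exists_holomorphic_root {S A B : ℂ × ℂ → ℂ} {q : ℂ × ℂ} {p : ℂ}
    (hS : AnalyticAt ℂ S q) (hA : AnalyticAt ℂ A q) (hB : AnalyticAt ℂ B q)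
    (hp : cubicEval (S q) (A q) (B q) p = 0) (hp' : 3 * p ^ 2 + 2 * S q * p + A q ≠ 0) :
    ∃ f : ℂ × ℂ → ℂ, f q = p ∧ (∀ᶠ x in 𝓝 q, DifferentiableAt ℂ f x) ∧
      ∀ᶠ x in 𝓝 q, cubicEval (S x) (A x) (B x) (f x) = 0 := by
  let u : (ℂ × ℂ) × ℂ := (q, p)
  let Φ : (ℂ × ℂ) × ℂ → ℂ := fun z => cubicEval (S z.1) (A z.1) (B z.1) z.2
  have hΦ : AnalyticAt ℂ Φ u := by
    have h1 : AnalyticAt ℂ (fun z : (ℂ × ℂ) × ℂ => S z.1) u := hS.fun_comp analyticAt_fst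
    have h2 : AnalyticAt ℂ (fun z : (ℂ × ℂ) × ℂ => A z.1) u := hA.fun_comp analyticAt_fst
    have h3 : AnalyticAt ℂ (fun z : (ℂ × ℂ) × ℂ => B z.1) u := hB.fun_comp analyticAt_fst
    have h4 : AnalyticAt ℂ (fun z : (ℂ × ℂ) × ℂ => z.2) u := analyticAt_snd
    exact (((h4.pow 3).add (h1.mul (h4.pow 2))).add (h2.mul h4)).add h3
  have cdf : ContDiffAt ℂ 1 Φ u := hΦ.contDiffAt
  have hder : ∀ t : ℂ, (fderiv ℂ Φ u ∘L ContinuousLinearMap.inr ℂ (ℂ × ℂ) ℂ) t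
      = (3 * p ^ 2 + 2 * S q * p + A q) * t := by
    intro t
    have h1 : HasDerivAt (fun s : ℂ => Φ (q, s)) (3 * p ^ 2 + 2 * S q * p + A q) p := by
      have := ((((hasDerivAt_id p).pow 3).add (((hasDerivAt_id p).pow 2).const_mul (S q))).add
        ((hasDerivAt_id p).const_mul (A q))).add_const (B q)
      refine (this.congr_deriv ?_).congr_of_eventuallyEq (Eventually.of_forall fun s => ?_)
      · simp; ring
      · simp [Φ, cubicEval]
    have h2 : HasDerivAt (fun s : ℂ => Φ (q, s))
        ((fderiv ℂ Φ u) ((0 : ℂ × ℂ), (1 : ℂ))) p :=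
      (hΦ.differentiableAt.hasFDerivAt).comp_hasDerivAt p
        ((hasDerivAt_const p q).prodMk (hasDerivAt_id p))
    have h3 := h2.unique h1
    have h4 : ((0 : ℂ × ℂ), t) = t • ((0 : ℂ × ℂ), (1 : ℂ)) := by simp
    simp only [ContinuousLinearMap.comp_apply, ContinuousLinearMap.inr_apply]
    rw [h4, map_smul, h3, smul_eq_mul, mul_comm]
  have if₂ : (fderiv ℂ Φ u ∘L ContinuousLinearMap.inr ℂ (ℂ × ℂ) ℂ).IsInvertible := by
    refine ⟨ContinuousLinearEquiv.unitsEquivAut ℂ (Units.mk0 _ hp'), ?_⟩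
    ext
    rw [hder]
    simp
  refine ⟨cdf.implicitFunction one_ne_zero if₂, cdf.implicitFunction_apply_self one_ne_zero if₂,
    ?_, ?_⟩
  · have h := cdf.contDiffAt_implicitFunction one_ne_zero if₂
    exact (h.eventually (by simp)).mono fun x hx => hx.differentiableAt one_ne_zero
  · refine (cdf.eventually_apply_implicitFunction one_ne_zero if₂).mono fun x hx => ?_
    have : Φ u = 0 := hp
    rw [this] at hx
    exact hx

/-- A linear symmetry of the solution web scales every root of the cubic, so its action on the
coefficients gives a quadratic equation satisfied by the roots. -/
theorem weighted_quadratic_of_root {U : Set (ℂ × ℂ)} (hU : IsOpen U) {S A B : ℂ × ℂ → ℂ}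
    (hS : AnalyticOnNhd ℂ S U) (hA : AnalyticOnNhd ℂ A U) (hB : AnalyticOnNhd ℂ B U) {wx wy : ℂ}
    (hX : IsInfinitesimalSymmetry (solutionWeb S A B) U (weightedField wx wy))
    {q : ℂ × ℂ} (hq : q ∈ U) (hreg : cubicDisc (S q) (A q) (B q) ≠ 0) {p : ℂ}
    (hp : cubicEval (S q) (A q) (B q) p = 0) :
    (fderiv ℂ S q (weightedField wx wy q) - (wy - wx) * S q) * p ^ 2
      + (fderiv ℂ A q (weightedField wx wy q) - 2 * (wy - wx) * A q) * p
      + (fderiv ℂ B q (weightedField wx wy q) - 3 * (wy - wx) * B q) = 0 := by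
  -- A double root would make the discriminant vanish.
  have hp' : 3 * p ^ 2 + 2 * S q * p + A q ≠ 0 := by
    intro h
    apply hreg
    have hB' : B q = 2 * p ^ 3 + S q * p ^ 2 := by
      unfold cubicEval at hp; linear_combination hp - p * h
    have hA' : A q = -(3 * p ^ 2 + 2 * S q * p) := by linear_combination h
    rw [hB', hA']; unfold cubicDisc; ring
  obtain ⟨f, hfq, hfd, hf⟩ := exists_holomorphic_root (hS q hq) (hA q hq) (hB q hq) hp hp'
  have hdisc : ∀ᶠ x in 𝓝 q, cubicDisc (S x) (A x) (B x) ≠ 0 := by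
    have h1 := (hS q hq).continuousAt
    have h2 := (hA q hq).continuousAt
    have h3 := (hB q hq).continuousAt
    have : ContinuousAt (fun x => cubicDisc (S x) (A x) (B x)) q := by
      unfold cubicDisc; fun_prop
    exact this.eventually_ne hreg
  obtain ⟨N, hN, hNo, hqN⟩ := eventually_nhds_iff.1
    (((hfd.and hf).and hdisc).and (hU.mem_nhds hq))
  have hbr := hX N (fun x hx => (hN x hx).2) hNo
    (fun x hx => isRegularPoint_solutionWeb_iff_disc.2 (hN x hx).1.2) (fun x => ((1 : ℂ), f x))
    (fun x hx => ((differentiableAt_const _).prodMk (hN x hx).1.1.1).differentiableWithinAt)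
    (fun x hx => ⟨fun h => one_ne_zero (congrArg Prod.fst h), f x, (hN x hx).1.1.2, rfl⟩) q hqN
  have hfder := hfd.self_of_nhds.hasFDerivAt
  have hv : HasFDerivAt (fun x => ((1 : ℂ), f x)) _ q := (hasFDerivAt_const (1 : ℂ) q).prodMk hfder
  have hXd : HasFDerivAt (weightedField wx wy) ((wx • ContinuousLinearMap.fst ℂ ℂ ℂ).prod
      (wy • ContinuousLinearMap.snd ℂ ℂ ℂ)) q :=
    ((wx • ContinuousLinearMap.fst ℂ ℂ ℂ).prod (wy • ContinuousLinearMap.snd ℂ ℂ ℂ)).hasFDerivAt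
  obtain ⟨c, hc⟩ := Submodule.mem_span_singleton.1 hbr
  rw [VectorField.lieBracket, hv.fderiv, hXd.fderiv] at hc
  have h1 := congrArg Prod.fst hc
  have h2 := congrArg Prod.snd hc
  simp [hfq] at h1 h2
  set X := weightedField wx wy q
  -- The field `(1, f)` has constant first component, which forces the factor of proportionality to
  -- be `-wx`; the second component then gives the weight of the root.
  have hXf : fderiv ℂ f q X = (wy - wx) * p := by
    subst h1
    linear_combination -h2
  have hS' := (hS q hq).differentiableAt.hasFDerivAt
  have hA' := (hA q hq).differentiableAt.hasFDerivAt
  have hB' := (hB q hq).differentiableAt.hasFDerivAt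
  have hP := (((hfder.pow 3).add (hS'.mul (hfder.pow 2))).add (hA'.mul hfder)).add hB'
  have hP0 := hP.unique ((hasFDerivAt_const (0 : ℂ) q).congr_of_eventuallyEq hf)
  have hPX := congrArg (fun L : ℂ × ℂ →L[ℂ] ℂ => L X) hP0
  simp [hfq, hXf] at hPX
  unfold cubicEval at hp
  -- Subtracting `3 (wy - wx)` times the cubic removes the `p³` term and leaves a quadratic.
  linear_combination hPX - 3 * (wy - wx) * hp

theorem coeffs_weighted_of_regular {U : Set (ℂ × ℂ)} (hU : IsOpen U) {S A B : ℂ × ℂ → ℂ}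
    (hS : AnalyticOnNhd ℂ S U) (hA : AnalyticOnNhd ℂ A U) (hB : AnalyticOnNhd ℂ B U) {wx wy : ℂ}
    (hX : IsInfinitesimalSymmetry (solutionWeb S A B) U (weightedField wx wy))
    {q : ℂ × ℂ} (hq : q ∈ U) (hreg : cubicDisc (S q) (A q) (B q) ≠ 0) :
    fderiv ℂ S q (weightedField wx wy q) - (wy - wx) * S q = 0 ∧
    fderiv ℂ A q (weightedField wx wy q) - 2 * (wy - wx) * A q = 0 ∧
    fderiv ℂ B q (weightedField wx wy q) - 3 * (wy - wx) * B q = 0 := by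
  obtain ⟨p₁, p₂, p₃, h⟩ := exists_cubicRoots_iff.2 hreg
  exact quadratic_coeffs_eq_zero h.ne₁₂ h.ne₁₃ h.ne₂₃
    (weighted_quadratic_of_root hU hS hA hB hX hq hreg h.root₁)
    (weighted_quadratic_of_root hU hS hA hB hX hq hreg h.root₂)
    (weighted_quadratic_of_root hU hS hA hB hX hq hreg h.root₃)

theorem cubicDisc_analyticOnNhd {U : Set (ℂ × ℂ)} {S A B : ℂ × ℂ → ℂ}
    (hS : AnalyticOnNhd ℂ S U) (hA : AnalyticOnNhd ℂ A U) (hB : AnalyticOnNhd ℂ B U) :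
    AnalyticOnNhd ℂ (fun q => cubicDisc (S q) (A q) (B q)) U := by
  intro q hq
  have := hS q hq
  have := hA q hq
  have := hB q hq
  unfold cubicDisc
  fun_prop

/-- On a connected domain, the regular points are dense as soon as they accumulate somewhere. -/
theorem frequently_cubicDisc_ne_zero {U : Set (ℂ × ℂ)} (hU : IsPreconnected U)
    {S A B : ℂ × ℂ → ℂ}
    (hS : AnalyticOnNhd ℂ S U) (hA : AnalyticOnNhd ℂ A U) (hB : AnalyticOnNhd ℂ B U)
    {q₀ : ℂ × ℂ} (hq₀ : U ∈ 𝓝 q₀) (hreg : ∃ᶠ q in 𝓝 q₀, cubicDisc (S q) (A q) (B q) ≠ 0)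
    {q : ℂ × ℂ} (hq : q ∈ U) : ∃ᶠ x in 𝓝 q, cubicDisc (S x) (A x) (B x) ≠ 0 := by
  intro h
  have h0 := (cubicDisc_analyticOnNhd hS hA hB).eqOn_zero_of_preconnected_of_eventuallyEq_zero
    hU hq (h.mono fun x hx => not_not.1 hx)
  exact hreg (Filter.mem_of_superset hq₀ fun x hx => not_not.2 (h0 hx))

theorem eq_zero_of_frequently {X : Type*} [TopologicalSpace X] (f : X → ℂ) {q : X}
    (hf : ContinuousAt f q) (h : ∃ᶠ x in 𝓝 q, f x = 0) : f q = 0 := by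
  by_contra h0
  exact h (hf.eventually_ne h0)

/-- At a regular point the quadratic has three distinct zeros, so its coefficients vanish; at other
points the identities persist by continuity. -/
theorem coeffs_weighted {U : Set (ℂ × ℂ)} (hU : IsOpen U) {S A B : ℂ × ℂ → ℂ}
    (hS : AnalyticOnNhd ℂ S U) (hA : AnalyticOnNhd ℂ A U) (hB : AnalyticOnNhd ℂ B U) {wx wy : ℂ}
    (hX : IsInfinitesimalSymmetry (solutionWeb S A B) U (weightedField wx wy))
    {q : ℂ × ℂ} (hq : q ∈ U) (hreg : ∃ᶠ x in 𝓝 q, cubicDisc (S x) (A x) (B x) ≠ 0) :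
    fderiv ℂ S q (weightedField wx wy q) - (wy - wx) * S q = 0 ∧
    fderiv ℂ A q (weightedField wx wy q) - 2 * (wy - wx) * A q = 0 ∧
    fderiv ℂ B q (weightedField wx wy q) - 3 * (wy - wx) * B q = 0 := by
  have hcont : ∀ (f : ℂ × ℂ → ℂ) (c : ℂ), AnalyticOnNhd ℂ f U → ContinuousAt
      (fun x => fderiv ℂ f x (weightedField wx wy x) - c * f x) q := by
    intro f c hf
    have h1 := (hf.fderiv q hq).continuousAt
    have h2 := (hf q hq).continuousAt
    have h3 : ContinuousAt (weightedField wx wy) q := by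
      unfold weightedField; fun_prop
    exact (h1.clm_apply h3).sub (continuousAt_const.mul h2)
  have hev := hreg.and_eventually (hU.mem_nhds hq)
  refine ⟨?_, ?_, ?_⟩
  · exact eq_zero_of_frequently (fun x => fderiv ℂ S x (weightedField wx wy x)
      - (wy - wx) * S x) (hcont S _ hS) (hev.mono fun x hx =>
        (coeffs_weighted_of_regular hU hS hA hB hX hx.2 hx.1).1)
  · exact eq_zero_of_frequently (fun x => fderiv ℂ A x (weightedField wx wy x)
      - 2 * (wy - wx) * A x) (hcont A _ hA) (hev.mono fun x hx =>
        (coeffs_weighted_of_regular hU hS hA hB hX hx.2 hx.1).2.1)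
  · exact eq_zero_of_frequently (fun x => fderiv ℂ B x (weightedField wx wy x)
      - 3 * (wy - wx) * B x) (hcont B _ hB) (hev.mono fun x hx =>
        (coeffs_weighted_of_regular hU hS hA hB hX hx.2 hx.1).2.2)

/-! ### The Frobenius structure built from the coefficients. -/

noncomputable section

/-- The bilinear map `(u, v) ↦ u_i v_j e_k` on `ℂ³`. -/
def elementaryBilin (i j k : Fin 3) : (Fin 3 → ℂ) →L[ℂ] (Fin 3 → ℂ) →L[ℂ] (Fin 3 → ℂ) :=
  (ContinuousLinearMap.proj (R := ℂ) (φ := fun _ : Fin 3 => ℂ) i).smulRight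
    ((ContinuousLinearMap.proj (R := ℂ) (φ := fun _ : Fin 3 => ℂ) j).smulRight
      (Pi.single k (1 : ℂ) : Fin 3 → ℂ))

@[simp] theorem elementaryBilin_apply (i j k : Fin 3) (u v : Fin 3 → ℂ) :
    elementaryBilin i j k u v = (u i * v j) • (Pi.single k (1 : ℂ) : Fin 3 → ℂ) := by
  simp [elementaryBilin, mul_smul]

/-- The multiplication of `ℂ³` with structure constants `a = f₁₁₁`, `b = f₁₁₂`, `c = f₁₂₂`,
`d = f₂₂₂`, for the potential `t₀² t₂ / 2 + t₀ t₁² / 2 + f(t₁, t₂)`. -/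
def wdvvMul (a b c d : ℂ) : (Fin 3 → ℂ) →L[ℂ] (Fin 3 → ℂ) →L[ℂ] (Fin 3 → ℂ) :=
  (elementaryBilin 0 0 0 + elementaryBilin 0 1 1 + elementaryBilin 1 0 1 + elementaryBilin 0 2 2
    + elementaryBilin 2 0 2 + elementaryBilin 1 1 2)
  + a • elementaryBilin 1 1 1
  + b • (elementaryBilin 1 1 0 + elementaryBilin 1 2 1 + elementaryBilin 2 1 1)
  + c • (elementaryBilin 1 2 0 + elementaryBilin 2 1 0 + elementaryBilin 2 2 1)
  + d • elementaryBilin 2 2 0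

theorem wdvvMul_apply (a b c d : ℂ) (u v : Fin 3 → ℂ) : wdvvMul a b c d u v =
    ![u 0 * v 0 + b * (u 1 * v 1) + c * (u 1 * v 2 + u 2 * v 1) + d * (u 2 * v 2),
      u 0 * v 1 + u 1 * v 0 + a * (u 1 * v 1) + b * (u 1 * v 2 + u 2 * v 1) + c * (u 2 * v 2),
      u 0 * v 2 + u 2 * v 0 + u 1 * v 1] := by
  simp only [wdvvMul, add_apply, smul_apply, elementaryBilin_apply]
  ext i
  fin_cases i <;> simp <;> ring

/-- The inner product `u₀ v₂ + u₁ v₁ + u₂ v₀` on `ℂ³`. -/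
def antidiagForm : (Fin 3 → ℂ) →L[ℂ] (Fin 3 → ℂ) →L[ℂ] ℂ :=
  (ContinuousLinearMap.compL ℂ (Fin 3 → ℂ) (Fin 3 → ℂ) ℂ
    (ContinuousLinearMap.proj (R := ℂ) (φ := fun _ : Fin 3 => ℂ) 0)).comp
    (elementaryBilin 0 2 0 + elementaryBilin 1 1 0 + elementaryBilin 2 0 0)

@[simp] theorem antidiagForm_apply (u v : Fin 3 → ℂ) :
    antidiagForm u v = u 0 * v 2 + u 1 * v 1 + u 2 * v 0 := by
  simp [antidiagForm]

/-- The projection of `ℂ³` along the unity vector field to the `(x, y)`-plane. -/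
def planeProj : (Fin 3 → ℂ) →L[ℂ] ℂ × ℂ :=
  (ContinuousLinearMap.proj (R := ℂ) (φ := fun _ : Fin 3 => ℂ) 2).prod
    (ContinuousLinearMap.proj (R := ℂ) (φ := fun _ : Fin 3 => ℂ) 1)

@[simp] theorem planeProj_apply (t : Fin 3 → ℂ) : planeProj t = (t 2, t 1) := rfl

/-- The linear section of `planeProj` with image `t₀ = 0`. -/
def planeSection : ℂ × ℂ →L[ℂ] (Fin 3 → ℂ) :=
  ContinuousLinearMap.pi ![0, ContinuousLinearMap.snd ℂ ℂ ℂ, ContinuousLinearMap.fst ℂ ℂ ℂ]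

@[simp] theorem planeSection_apply (q : ℂ × ℂ) : planeSection q = ![0, q.2, q.1] := by
  ext i
  fin_cases i <;> simp [planeSection]

/-- The diagonal linear Euler field. -/
def linearEuler (w : Fin 3 → ℂ) : (Fin 3 → ℂ) →L[ℂ] (Fin 3 → ℂ) :=
  ContinuousLinearMap.pi fun i => w i • ContinuousLinearMap.proj i

@[simp] theorem linearEuler_apply (w t : Fin 3 → ℂ) :
    linearEuler w t = ![w 0 * t 0, w 1 * t 1, w 2 * t 2] := by
  ext i
  fin_cases i <;> simp [linearEuler]

variable {U : Set (ℂ × ℂ)} {S A B : ℂ × ℂ → ℂ}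

/-- The multiplication on the tangent spaces of `ℂ³` determined by a cubic equation. -/
def cubicMul (S A B : ℂ × ℂ → ℂ) (t : Fin 3 → ℂ) :
    (Fin 3 → ℂ) →L[ℂ] (Fin 3 → ℂ) →L[ℂ] (Fin 3 → ℂ) :=
  wdvvMul (-S (planeProj t)) (-A (planeProj t) / 2) (-B (planeProj t))
    (A (planeProj t) ^ 2 / 4 - S (planeProj t) * B (planeProj t))

theorem cubicMul_apply (t u v : Fin 3 → ℂ) : cubicMul S A B t u v =
    wdvvMul (-S (planeProj t)) (-A (planeProj t) / 2) (-B (planeProj t))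
      (A (planeProj t) ^ 2 / 4 - S (planeProj t) * B (planeProj t)) u v := rfl

theorem analyticAt_smul_const {E F : Type*} [NormedAddCommGroup E] [NormedSpace ℂ E]
    [NormedAddCommGroup F] [NormedSpace ℂ F] {f : E → ℂ} {x : E} (hf : AnalyticAt ℂ f x) (c : F) :
    AnalyticAt ℂ (fun x => f x • c) x :=
  hf.smul analyticAt_const

theorem cubicMul_analytic (hS : AnalyticOnNhd ℂ S U) (hA : AnalyticOnNhd ℂ A U)
    (hB : AnalyticOnNhd ℂ B U) : AnalyticOnNhd ℂ (cubicMul S A B) (planeProj ⁻¹' U) := by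
  intro t ht
  have hπ : AnalyticAt ℂ planeProj t := planeProj.analyticAt t
  have h1 : AnalyticAt ℂ (fun t => S (planeProj t)) t := (hS _ ht).fun_comp hπ
  have h2 : AnalyticAt ℂ (fun t => A (planeProj t)) t := (hA _ ht).fun_comp hπ
  have h3 : AnalyticAt ℂ (fun t => B (planeProj t)) t := (hB _ ht).fun_comp hπ
  have h4 : AnalyticAt ℂ (fun t => -A (planeProj t) / 2) t := by
    simp only [div_eq_mul_inv]; exact h2.neg.mul analyticAt_const
  have h5 : AnalyticAt ℂ
      (fun t => A (planeProj t) ^ 2 / 4 - S (planeProj t) * B (planeProj t)) t := by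
    simp only [div_eq_mul_inv]; exact ((h2.pow 2).mul analyticAt_const).sub (h1.mul h3)
  have hsmul : ∀ (f : (Fin 3 → ℂ) → ℂ) (T : (Fin 3 → ℂ) →L[ℂ] (Fin 3 → ℂ) →L[ℂ] (Fin 3 → ℂ)),
      AnalyticAt ℂ f t → AnalyticAt ℂ (fun x => f x • T) t := fun f T hf =>
    analyticAt_smul_const hf T
  exact (((analyticAt_const.add (hsmul _ _ h1.neg)).add (hsmul _ _ h4)).add
    (hsmul _ _ h3.neg)).add (hsmul _ _ h5)

/-- Directional derivatives in terms of partial derivatives. -/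
theorem fderiv_apply_eq_dx_dy (f : ℂ × ℂ → ℂ) (q v : ℂ × ℂ) :
    fderiv ℂ f q v = v.1 * dx f q + v.2 * dy f q := by
  have : v = v.1 • ((1 : ℂ), (0 : ℂ)) + v.2 • ((0 : ℂ), (1 : ℂ)) := by ext <;> simp
  conv_lhs => rw [this]
  simp only [map_add, map_smul, smul_eq_mul, dx, dy]

/-- The derivative of the product of two constant vector fields. -/
theorem hasFDerivAt_cubicMul {t : Fin 3 → ℂ} (hS : DifferentiableAt ℂ S (planeProj t))
    (hA : DifferentiableAt ℂ A (planeProj t)) (hB : DifferentiableAt ℂ B (planeProj t))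
    (u v : Fin 3 → ℂ) : ∃ L : (Fin 3 → ℂ) →L[ℂ] (Fin 3 → ℂ),
      HasFDerivAt (fun x => cubicMul S A B x u v) L t ∧ ∀ z, L z =
        wdvvMul (-fderiv ℂ S (planeProj t) (planeProj z))
          (-fderiv ℂ A (planeProj t) (planeProj z) / 2) (-fderiv ℂ B (planeProj t) (planeProj z))
          (A (planeProj t) * fderiv ℂ A (planeProj t) (planeProj z) / 2
            - S (planeProj t) * fderiv ℂ B (planeProj t) (planeProj z)
            - B (planeProj t) * fderiv ℂ S (planeProj t) (planeProj z)) u v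
          - wdvvMul 0 0 0 0 u v := by
  have h1 := hS.hasFDerivAt.comp t planeProj.hasFDerivAt
  have h2 := hA.hasFDerivAt.comp t planeProj.hasFDerivAt
  have h3 := hB.hasFDerivAt.comp t planeProj.hasFDerivAt
  have h4 := h2.neg.mul_const (2⁻¹ : ℂ)
  have h5 := ((h2.pow 2).mul_const (4⁻¹ : ℂ)).sub (h1.mul h3)
  -- Only the summands with variable coefficients contribute; the constant part is `wdvvMul 0 0 0
  -- 0`, which is why it is subtracted in the formula for `L`.
  have H := ((((h1.neg.smul_const (elementaryBilin 1 1 1 u v)).add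
    (h4.smul_const
      ((elementaryBilin 1 1 0 + elementaryBilin 1 2 1 + elementaryBilin 2 1 1) u v))).add
    (h3.neg.smul_const
      ((elementaryBilin 1 2 0 + elementaryBilin 2 1 0 + elementaryBilin 2 2 1) u v))).add
    (h5.smul_const (elementaryBilin 2 2 0 u v))).const_add ((elementaryBilin 0 0 0
      + elementaryBilin 0 1 1 + elementaryBilin 1 0 1 + elementaryBilin 0 2 2
      + elementaryBilin 2 0 2 + elementaryBilin 1 1 2) u v)
  refine ⟨_, H.congr_of_eventuallyEq (Eventually.of_forall fun x => ?_), fun z => ?_⟩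
  · simp only [cubicMul, wdvvMul, add_apply, smul_apply,
      Pi.add_apply, Pi.sub_apply, Pi.neg_apply, Pi.mul_apply, Function.comp_apply,
      div_eq_mul_inv]
    module
  · simp only [wdvvMul, add_apply, smul_apply,
      ContinuousLinearMap.smulRight_apply, neg_apply,
      sub_apply, ContinuousLinearMap.comp_apply, Function.comp_apply,
      smul_eq_mul]
    match_scalars <;> ring

theorem wdvvMul_comm (a b c d : ℂ) (u v : Fin 3 → ℂ) :
    wdvvMul a b c d u v = wdvvMul a b c d v u := by
  simp only [wdvvMul_apply]; ext i; fin_cases i <;> simp <;> ring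

/-- For a three-dimensional algebra of this shape the WDVV equations reduce to the single relation
`hd`. -/
theorem wdvvMul_assoc (a b c d : ℂ) (hd : d = b ^ 2 - a * c) (u v w : Fin 3 → ℂ) :
    wdvvMul a b c d (wdvvMul a b c d u v) w = wdvvMul a b c d u (wdvvMul a b c d v w) := by
  subst hd
  simp only [wdvvMul_apply]; ext i; fin_cases i <;> simp <;> ring

theorem antidiagForm_wdvvMul (a b c d : ℂ) (u v w : Fin 3 → ℂ) :
    antidiagForm (wdvvMul a b c d u v) w = antidiagForm u (wdvvMul a b c d v w) := by
  simp [wdvvMul_apply]; ring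

theorem wdvvMul_unit (a b c d : ℂ) (v : Fin 3 → ℂ) : wdvvMul a b c d ![1, 0, 0] v = v := by
  rw [wdvvMul_apply]; ext i; fin_cases i <;> simp

/-- The connection is zero in flat coordinates, so this is a plain derivative. Symmetry in `u, v, w`
is visible on the right; only exchanging `z` with them needs the differential equations. -/
theorem covDerivTensor_cubicMul {t : Fin 3 → ℂ} (hS : DifferentiableAt ℂ S (planeProj t))
    (hA : DifferentiableAt ℂ A (planeProj t)) (hB : DifferentiableAt ℂ B (planeProj t))
    (z u v w : Fin 3 → ℂ) :
    covDerivTensor 0 (fun x a b c => antidiagForm (cubicMul S A B x a b) c) t z u v w =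
      -fderiv ℂ S (planeProj t) (planeProj z) * (u 1 * v 1 * w 1)
      - fderiv ℂ A (planeProj t) (planeProj z) / 2
        * (u 1 * v 1 * w 2 + u 1 * v 2 * w 1 + u 2 * v 1 * w 1)
      - fderiv ℂ B (planeProj t) (planeProj z)
        * (u 1 * v 2 * w 2 + u 2 * v 1 * w 2 + u 2 * v 2 * w 1)
      + (A (planeProj t) * fderiv ℂ A (planeProj t) (planeProj z) / 2
            - S (planeProj t) * fderiv ℂ B (planeProj t) (planeProj z)
            - B (planeProj t) * fderiv ℂ S (planeProj t) (planeProj z)) * (u 2 * v 2 * w 2) := by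
  obtain ⟨L, hL, hLz⟩ := hasFDerivAt_cubicMul hS hA hB u v
  have h := (antidiagForm.flip w).hasFDerivAt.comp t hL
  have h' : HasFDerivAt (fun x => antidiagForm (cubicMul S A B x u v) w)
      ((antidiagForm.flip w).comp L) t := h
  unfold covDerivTensor
  rw [h'.fderiv]
  simp only [ContinuousLinearMap.comp_apply, hLz, ContinuousLinearMap.flip_apply, Pi.zero_apply,
    zero_apply, map_zero, map_sub,
    antidiagForm_apply, wdvvMul_apply]
  simp
  ring

/-- The Frobenius structure on the cylinder over a plane domain determined by a solution of the
hydrodynamic system that is homogeneous with respect to a linear vector field. -/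
def cubicFrobeniusStructure (hU : IsOpen U) (hS : AnalyticOnNhd ℂ S U)
    (hA : AnalyticOnNhd ℂ A U) (hB : AnalyticOnNhd ℂ B U) (hPDE : HydrodynamicSystem U S A B)
    (wx wy : ℂ)
    (hwt : ∀ q ∈ U, fderiv ℂ S q (weightedField wx wy q) - (wy - wx) * S q = 0 ∧
      fderiv ℂ A q (weightedField wx wy q) - 2 * (wy - wx) * A q = 0 ∧
      fderiv ℂ B q (weightedField wx wy q) - 3 * (wy - wx) * B q = 0) :
    FrobeniusStructure (planeProj ⁻¹' U) where
  isOpen := hU.preimage planeProj.continuous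
  mul := cubicMul S A B
  metric := fun _ => antidiagForm
  conn := 0
  unit := fun _ => ![1, 0, 0]
  -- The weights of `t₁ = y` and `t₂ = x` are prescribed by `X`. The metric scales only if the
  -- weights of `t₀` and `t₂` add up to `2 * wy`, which fixes the first one.
  euler := linearEuler ![2 * wy - wx, wy, wx]
  mul_analytic := cubicMul_analytic hS hA hB
  metric_analytic := analyticOnNhd_const
  conn_analytic := analyticOnNhd_const
  unit_analytic := analyticOnNhd_const
  euler_analytic := (linearEuler _).analyticOnNhd _
  mul_comm := fun _ _ => wdvvMul_comm _ _ _ _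
  mul_assoc := fun _ _ => wdvvMul_assoc _ _ _ _ (by ring)
  metric_symm := fun _ _ u v => by simp; ring
  metric_nondegenerate := fun _ _ u h => by
    have h0 := h ![0, 0, 1]
    have h1 := h ![0, 1, 0]
    have h2 := h ![1, 0, 0]
    simp at h0 h1 h2
    ext i
    fin_cases i <;> simpa
  metric_invariant := fun _ _ => antidiagForm_wdvvMul _ _ _ _
  conn_leviCivita := ⟨fun _ _ _ _ => rfl, fun _ _ z u v => by simp⟩
  flat := fun _ _ u v w => by simp [curvature]
  unit_mul := fun _ _ => wdvvMul_unit _ _ _ _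
  unit_parallel := fun _ _ u => by simp [covDeriv]
  euler_linear := fun p _ u v => by
    simp [covDeriv₂, covDeriv]
  euler_rescales_mul := by
    -- The factor is the weight of `t₀`, as read off from `e · e = e`.
    refine ⟨2 * wy - wx, fun p hp u v => ?_⟩
    obtain ⟨L, hL, hLz⟩ := hasFDerivAt_cubicMul (hS _ hp).differentiableAt
      (hA _ hp).differentiableAt (hB _ hp).differentiableAt u v
    obtain ⟨h1, h2, h3⟩ := hwt _ hp
    have hE : planeProj (linearEuler ![2 * wy - wx, wy, wx] p)
        = weightedField wx wy (planeProj p) := by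
      ext <;> simp [weightedField]
    rw [lieDerivMul, hL.fderiv, hLz, hE, sub_eq_zero.1 h1, sub_eq_zero.1 h2, sub_eq_zero.1 h3,
      ContinuousLinearMap.fderiv]
    simp only [cubicMul_apply, wdvvMul_apply]
    ext i
    fin_cases i <;> simp <;> ring
  euler_rescales_metric := by
    refine ⟨2 * wy, fun p hp u v => ?_⟩
    simp [lieDerivForm]
    ring
  potential := fun p hp z u v w => by
    obtain ⟨h1, h2, h3⟩ := hPDE _ hp
    simp only [covDerivTensor_cubicMul (hS _ hp).differentiableAt
      (hA _ hp).differentiableAt (hB _ hp).differentiableAt, fderiv_apply_eq_dx_dy, h1, h2, h3]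
    simp only [planeProj_apply]
    refine ⟨?_, ?_, ?_⟩ <;> ring

end

/-! ### Idempotents of the cubic algebra and the booklet directions. -/

noncomputable section

/-- The multiplication of `ℂ[z]/(z³ + s z² + a z + b)` in the basis `1, z, z² + s z + a / 2`. -/
def cubicAlgebraMul (s a b : ℂ) : (Fin 3 → ℂ) →L[ℂ] (Fin 3 → ℂ) →L[ℂ] (Fin 3 → ℂ) :=
  wdvvMul (-s) (-a / 2) (-b) (a ^ 2 / 4 - s * b)

/-- `ε` consists of independent orthogonal idempotents. -/
def IsCubicFrame (s a b : ℂ) (ε : Fin 3 → Fin 3 → ℂ) : Prop :=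
  LinearIndependent ℂ ε ∧ ∀ i j, cubicAlgebraMul s a b (ε i) (ε j) = if i = j then ε i else 0

variable {s a b : ℂ} {ε : Fin 3 → Fin 3 → ℂ}

theorem cubicAlgebraMul_unit (v : Fin 3 → ℂ) : cubicAlgebraMul s a b ![1, 0, 0] v = v :=
  wdvvMul_unit _ _ _ _ v

/-- If the last coordinate vanishes, idempotency kills the middle one, leaving a multiple of the
unity; such an element cannot annihilate another idempotent of the frame. -/
theorem IsCubicFrame.coord_ne_zero (h : IsCubicFrame s a b ε) (i : Fin 3) : ε i 2 ≠ 0 := by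
  intro h2
  have hi := h.2 i i
  rw [if_pos rfl, cubicAlgebraMul, wdvvMul_apply] at hi
  have e2 := congrFun hi 2
  simp [h2] at e2
  obtain ⟨j, hj⟩ : ∃ j, j ≠ i := exists_ne i
  have hij := h.2 i j
  have hu : ε i = ε i 0 • ![1, 0, 0] := by
    ext k; fin_cases k <;> simp [h2, e2]
  rw [if_neg hj.symm, hu, map_smul, smul_apply, cubicAlgebraMul_unit, smul_eq_zero] at hij
  rcases hij with h0 | h0
  · rw [h0, zero_smul] at hu
    exact h.1.ne_zero i hu
  · exact h.1.ne_zero j h0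

/-- Eliminating `ε i 0` between the last two coordinates of `ε i · ε i = ε i` leaves the homogenized
cubic. -/
theorem IsCubicFrame.root (h : IsCubicFrame s a b ε) (i : Fin 3) :
    cubicEval s a b (ε i 1 / ε i 2) = 0 := by
  have h2 := h.coord_ne_zero i
  have hi := h.2 i i
  rw [if_pos rfl, cubicAlgebraMul, wdvvMul_apply] at hi
  have e1 := congrFun hi 1
  have e2 := congrFun hi 2
  simp at e1 e2
  unfold cubicEval
  field_simp
  linear_combination ε i 1 * e2 - ε i 2 * e1

/-- Equal slopes would make a combination of `ε i` and `ε j` a multiple of the unity. Multiplying by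
the third idempotent shows that multiple is zero, and multiplying by `ε i` then gives a
contradiction. -/
theorem IsCubicFrame.root_ne (h : IsCubicFrame s a b ε) {i j : Fin 3} (hij : i ≠ j) :
    ε i 1 / ε i 2 ≠ ε j 1 / ε j 2 := by
  intro heq
  have hi := h.coord_ne_zero i
  have hj := h.coord_ne_zero j
  rw [div_eq_div_iff hi hj] at heq
  obtain ⟨k, hki, hkj⟩ : ∃ k, k ≠ i ∧ k ≠ j :=
    (by decide : ∀ i j : Fin 3, ∃ k, k ≠ i ∧ k ≠ j) i j
  set κ := ε j 2 * ε i 0 - ε i 2 * ε j 0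
  have hw : ε j 2 • ε i - ε i 2 • ε j = κ • ![1, 0, 0] := by
    ext l
    fin_cases l
    · simp [κ]
    · simp; linear_combination heq
    · simp; ring
  have hk := congrArg (fun w => cubicAlgebraMul s a b w (ε k)) hw
  have hi' := congrArg (fun w => cubicAlgebraMul s a b w (ε i)) hw
  simp only [map_sub, map_smul, sub_apply, smul_apply, h.2, cubicAlgebraMul_unit,
    if_neg hki.symm, if_neg hkj.symm, if_neg hij.symm, if_true, smul_zero, sub_zero] at hk hi'
  have hκ : κ = 0 := (smul_eq_zero.1 hk.symm).resolve_right (h.1.ne_zero k)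
  rw [hκ, zero_smul, smul_eq_zero] at hi'
  exact hi'.elim hj (h.1.ne_zero i)

theorem IsCubicFrame.cubicRoots (h : IsCubicFrame s a b ε) :
    CubicRoots s a b (ε 0 1 / ε 0 2) (ε 1 1 / ε 1 2) (ε 2 1 / ε 2 2) :=
  ⟨h.root_ne (by decide), h.root_ne (by decide), h.root_ne (by decide), h.root 0, h.root 1,
    h.root 2⟩

/-- The idempotent of the factor `z = p`, where `p, q, r` are the roots. -/
def rootIdempotent (p q r : ℂ) : Fin 3 → ℂ :=
  ((p - q) * (p - r))⁻¹ • ![q * r - (p * q + p * r + q * r) / 2, p, 1]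

theorem rootIdempotent_swap (p q r : ℂ) : rootIdempotent p r q = rootIdempotent p q r := by
  unfold rootIdempotent
  congr 1
  · ring
  · congr 1; ring

/-- Modulo the cubic, multiplying `(z - q)(z - r)` by a polynomial multiplies it by the value of
that polynomial at `p`; here the value is `(p - q)(p - r)`. -/
theorem rootIdempotent_mul_self {p q r : ℂ} (hpq : p ≠ q) (hpr : p ≠ r) :
    cubicAlgebraMul (-(p + q + r)) (p * q + p * r + q * r) (-(p * q * r))
      (rootIdempotent p q r) (rootIdempotent p q r) = rootIdempotent p q r := by
  have h : (p - q) * (p - r) ≠ 0 := mul_ne_zero (sub_ne_zero.2 hpq) (sub_ne_zero.2 hpr)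
  set n : Fin 3 → ℂ := ![q * r - (p * q + p * r + q * r) / 2, p, 1] with hn
  have key : cubicAlgebraMul (-(p + q + r)) (p * q + p * r + q * r) (-(p * q * r)) n n
      = ((p - q) * (p - r)) • n := by
    rw [cubicAlgebraMul, wdvvMul_apply, hn]
    ext i; fin_cases i <;> simp <;> ring
  have : rootIdempotent p q r = ((p - q) * (p - r))⁻¹ • n := rfl
  rw [this, map_smul, map_smul, smul_apply, key, inv_smul_smul₀ h]

/-- The product `(z - q)(z - r) · (z - p)(z - r)` is divisible by the cubic. -/
theorem rootIdempotent_mul_of_ne (p q r : ℂ) :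
    cubicAlgebraMul (-(p + q + r)) (p * q + p * r + q * r) (-(p * q * r))
      (rootIdempotent p q r) (rootIdempotent q p r) = 0 := by
  have key : cubicAlgebraMul (-(p + q + r)) (p * q + p * r + q * r) (-(p * q * r))
      ![q * r - (p * q + p * r + q * r) / 2, p, 1] ![p * r - (q * p + q * r + p * r) / 2, q, 1]
      = 0 := by
    rw [cubicAlgebraMul, wdvvMul_apply]
    ext i; fin_cases i <;> simp <;> ring
  unfold rootIdempotent
  rw [map_smul, map_smul, smul_apply, key, smul_zero, smul_zero]

theorem rootIdempotent_ne_zero {p q r : ℂ} (hpq : p ≠ q) (hpr : p ≠ r) :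
    rootIdempotent p q r ≠ 0 := by
  intro h
  have h2 := congrFun h 2
  simp [rootIdempotent, sub_eq_zero, hpq, hpr] at h2

theorem CubicRoots.isCubicFrame {p q r : ℂ} (h : CubicRoots s a b p q r) :
    IsCubicFrame s a b ![rootIdempotent p q r, rootIdempotent q p r, rootIdempotent r p q] := by
  obtain ⟨hpq, hpr, hqr, h1, h2, h3⟩ := h
  obtain ⟨hs, ha, hb⟩ := cubic_vieta hpq hpr hqr h1 h2 h3
  set ε : Fin 3 → Fin 3 → ℂ := ![rootIdempotent p q r, rootIdempotent q p r, rootIdempotent r p q]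
  have hmul : ∀ x y z : ℂ, s = -(x + y + z) → a = x * y + x * z + y * z → b = -(x * y * z) →
      cubicAlgebraMul s a b (rootIdempotent x y z) (rootIdempotent y x z) = 0 := by
    rintro x y z rfl rfl rfl
    exact rootIdempotent_mul_of_ne x y z
  have hself : ∀ x y z : ℂ, s = -(x + y + z) → a = x * y + x * z + y * z → b = -(x * y * z) →
      x ≠ y → x ≠ z →
      cubicAlgebraMul s a b (rootIdempotent x y z) (rootIdempotent x y z)
        = rootIdempotent x y z := by
    rintro x y z rfl rfl rfl hxy hxz
    exact rootIdempotent_mul_self hxy hxz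
  have htable : ∀ i j, cubicAlgebraMul s a b (ε i) (ε j) = if i = j then ε i else 0 := by
    have e00 := hself p q r hs ha hb hpq hpr
    have e11 := hself q p r (by rw [hs]; ring) (by rw [ha]; ring) (by rw [hb]; ring) hpq.symm hqr
    have e22 := hself r p q (by rw [hs]; ring) (by rw [ha]; ring) (by rw [hb]; ring)
      hpr.symm hqr.symm
    have e01 := hmul p q r hs ha hb
    have e10 := hmul q p r (by rw [hs]; ring) (by rw [ha]; ring) (by rw [hb]; ring)
    have e02 := hmul p r q (by rw [hs]; ring) (by rw [ha]; ring) (by rw [hb]; ring)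
    have e20 := hmul r p q (by rw [hs]; ring) (by rw [ha]; ring) (by rw [hb]; ring)
    have e12 := hmul q r p (by rw [hs]; ring) (by rw [ha]; ring) (by rw [hb]; ring)
    have e21 := hmul r q p (by rw [hs]; ring) (by rw [ha]; ring) (by rw [hb]; ring)
    rw [rootIdempotent_swap p q r] at e02 e20
    rw [rootIdempotent_swap q p r, rootIdempotent_swap r p q] at e12 e21
    intro i j
    fin_cases i <;> fin_cases j <;> simpa [ε]
  have hne : ∀ i, ε i ≠ 0 := by
    intro i
    fin_cases i
    · exact rootIdempotent_ne_zero hpq hpr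
    · exact rootIdempotent_ne_zero hpq.symm hqr
    · exact rootIdempotent_ne_zero hpr.symm hqr.symm
  -- Multiplying a linear relation by `ε j` isolates its `j`-th coefficient.
  refine ⟨Fintype.linearIndependent_iff.2 fun g hg j => ?_, htable⟩
  have h0 := congrArg (fun w => cubicAlgebraMul s a b (ε j) w) hg
  simp only [map_sum, map_smul, htable, smul_ite, smul_zero, map_zero, Finset.sum_ite_eq,
    Finset.mem_univ, if_true] at h0
  exact (smul_eq_zero.1 h0).resolve_right (hne j)

theorem comap_planeSection_span {u : Fin 3 → ℂ} (hu : u 2 ≠ 0) :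
    (Submodule.span ℂ {![1, 0, 0], u}).comap planeSection.toLinearMap
      = Submodule.span ℂ {((1 : ℂ), u 1 / u 2)} := by
  ext v
  rw [Submodule.mem_comap, Submodule.mem_span_pair, Submodule.mem_span_singleton]
  constructor
  · rintro ⟨x, y, h⟩
    have h1 := congrFun h 1
    have h2 := congrFun h 2
    simp at h1 h2
    refine ⟨v.1, Prod.ext (by simp) ?_⟩
    simp only [Prod.smul_mk, smul_eq_mul]
    rw [← h1, ← h2]
    field_simp
  · rintro ⟨c, rfl⟩
    refine ⟨-(c / u 2 * u 0), c / u 2, ?_⟩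
    ext i
    fin_cases i
    · simp
    · simp; field_simp
    · simp; field_simp

theorem isSemisimple_iff_disc : (∃ ε, IsCubicFrame s a b ε) ↔ cubicDisc s a b ≠ 0 := by
  rw [← exists_cubicRoots_iff]
  exact ⟨fun ⟨_, h⟩ => ⟨_, _, _, h.cubicRoots⟩, fun ⟨_, _, _, h⟩ => ⟨_, h.isCubicFrame⟩⟩

theorem booklet_eq_roots (hd : cubicDisc s a b ≠ 0) :
    {l : Submodule ℂ (ℂ × ℂ) | ∃ ε, IsCubicFrame s a b ε ∧
      ∃ i, l = (Submodule.span ℂ {![1, 0, 0], ε i}).comap planeSection.toLinearMap}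
    = {l | ∃ p : ℂ, cubicEval s a b p = 0 ∧ l = Submodule.span ℂ {((1 : ℂ), p)}} := by
  ext l
  constructor
  · rintro ⟨ε, hε, i, rfl⟩
    exact ⟨_, hε.root i, comap_planeSection_span (hε.coord_ne_zero i)⟩
  · rintro ⟨p, hp, rfl⟩
    obtain ⟨ε, hε⟩ := isSemisimple_iff_disc.2 hd
    obtain ⟨hs, ha, hb⟩ := cubic_vieta hε.cubicRoots.ne₁₂ hε.cubicRoots.ne₁₃ hε.cubicRoots.ne₂₃
      (hε.root 0) (hε.root 1) (hε.root 2)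
    -- The three slopes of a frame are distinct roots, hence all the roots.
    have hi : ∃ i, p = ε i 1 / ε i 2 := by
      have : (p - ε 0 1 / ε 0 2) * ((p - ε 1 1 / ε 1 2) * (p - ε 2 1 / ε 2 2)) = 0 := by
        rw [← hp, cubicEval, hs, ha, hb]; ring
      rcases mul_eq_zero.1 this with h | h
      · exact ⟨0, sub_eq_zero.1 h⟩
      · rcases mul_eq_zero.1 h with h | h
        · exact ⟨1, sub_eq_zero.1 h⟩
        · exact ⟨2, sub_eq_zero.1 h⟩
    obtain ⟨i, rfl⟩ := hi
    exact ⟨ε, hε, i, (comap_planeSection_span (hε.coord_ne_zero i)).symm⟩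

end

/-! ### Directions at singular points as limits, and the conclusion. -/

theorem planeProj_planeSection (q : ℂ × ℂ) : planeProj (planeSection q) = q := by
  simp

theorem planeSection_injective : Function.Injective planeSection :=
  Function.LeftInverse.injective planeProj_planeSection

/-- The directions of a cubic web at a point of a domain are the limits of its directions at
regular points, if these are dense. -/
theorem span_mem_solutionWeb_iff_mem_closure {U : Set (ℂ × ℂ)} (hU : IsOpen U)
    {S A B : ℂ × ℂ → ℂ} (hS : ContinuousOn S U) (hA : ContinuousOn A U) (hB : ContinuousOn B U)
    {q : ℂ × ℂ} (hq : q ∈ U) (hreg : ∃ᶠ x in 𝓝 q, cubicDisc (S x) (A x) (B x) ≠ 0)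
    {v : ℂ × ℂ} (hv : v ≠ 0) :
    Submodule.span ℂ {v} ∈ solutionWeb S A B q ↔
      (q, v) ∈ closure {z : (ℂ × ℂ) × (ℂ × ℂ) | z.1 ∈ U ∧ z.2 ≠ 0 ∧
        cubicDisc (S z.1) (A z.1) (B z.1) ≠ 0 ∧
        Submodule.span ℂ {z.2} ∈ solutionWeb S A B z.1} := by
  have cS := hS.continuousAt (hU.mem_nhds hq)
  have cA := hA.continuousAt (hU.mem_nhds hq)
  have cB := hB.continuousAt (hU.mem_nhds hq)
  constructor
  · rintro ⟨p, hp, hspan⟩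
    have hmem : v ∈ Submodule.span ℂ {((1 : ℂ), p)} := by
      rw [← hspan]; exact Submodule.mem_span_singleton_self _
    obtain ⟨c, rfl⟩ := Submodule.mem_span_singleton.1 hmem
    have hc : c ≠ 0 := by
      rintro rfl; simp at hv
    rw [Metric.mem_closure_iff]
    intro η hη
    -- The approximating direction is `c • (1, r)`, so the error in the root is multiplied by `‖c‖`;
    -- adding 1 makes the final estimate strict.
    have hδ : 0 < η / (‖c‖ + 1) := by positivity
    set δ := η / (‖c‖ + 1) with hδdef
    have hcont : ContinuousAt (fun x => cubicEval (S x) (A x) (B x) p) q := by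
      unfold cubicEval; fun_prop
    have hsmall : ∀ᶠ x in 𝓝 q, ‖cubicEval (S x) (A x) (B x) p‖ < δ ^ 3 := by
      refine hcont.norm.eventually_lt continuousAt_const ?_
      have : cubicEval (S q) (A q) (B q) p = 0 := hp
      rw [this, norm_zero]
      positivity
    obtain ⟨x, hx, ⟨hxs, hxU⟩, hxη⟩ := (hreg.and_eventually
      ((hsmall.and (hU.mem_nhds hq)).and (Metric.ball_mem_nhds q hη))).exists
    obtain ⟨r, hr, hrp⟩ := exists_root_near (s := S x) (a := A x) (b := B x) (p := p)
    have hpr : ‖p - r‖ < δ := lt_of_pow_lt_pow_left₀ 3 hδ.le (hrp.trans_lt hxs)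
    refine ⟨(x, c • ((1 : ℂ), r)), ⟨hxU, by simp [hc], hx, r, hr,
      Submodule.span_singleton_smul_eq (IsUnit.mk0 c hc) _⟩, ?_⟩
    rw [Prod.dist_eq, max_lt_iff]
    refine ⟨by simpa [dist_comm] using hxη, ?_⟩
    simp only [Prod.smul_mk, Prod.dist_eq, dist_self, smul_eq_mul]
    rw [max_lt_iff]
    refine ⟨hη, ?_⟩
    rw [dist_eq_norm, ← mul_sub, norm_mul]
    calc ‖c‖ * ‖p - r‖ ≤ ‖c‖ * δ := by gcongr
      _ < (‖c‖ + 1) * δ := by gcongr; linarith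
      _ = η := by rw [hδdef]; field_simp
  · intro h
    rw [span_mem_solutionWeb_iff hv]
    have hc : ContinuousAt (fun z : (ℂ × ℂ) × (ℂ × ℂ) => z.2.2 ^ 3 + S z.1 * z.2.2 ^ 2 * z.2.1
        + A z.1 * z.2.2 * z.2.1 ^ 2 + B z.1 * z.2.1 ^ 3) (q, v) := by
      have c1 : ContinuousAt (fun z : (ℂ × ℂ) × (ℂ × ℂ) => S z.1) (q, v) :=
        ContinuousAt.comp' (f := Prod.fst) cS continuousAt_fst
      have c2 : ContinuousAt (fun z : (ℂ × ℂ) × (ℂ × ℂ) => A z.1) (q, v) :=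
        ContinuousAt.comp' (f := Prod.fst) cA continuousAt_fst
      have c3 : ContinuousAt (fun z : (ℂ × ℂ) × (ℂ × ℂ) => B z.1) (q, v) :=
        ContinuousAt.comp' (f := Prod.fst) cB continuousAt_fst
      fun_prop
    exact eq_zero_of_frequently (fun z : (ℂ × ℂ) × (ℂ × ℂ) => z.2.2 ^ 3
      + S z.1 * z.2.2 ^ 2 * z.2.1 + A z.1 * z.2.2 * z.2.1 ^ 2 + B z.1 * z.2.1 ^ 3) hc
      ((mem_closure_iff_frequently.1 h).mono fun z hz =>
        (span_mem_solutionWeb_iff hz.2.1).1 hz.2.2.2)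

theorem mainTheorem3
    (U : Set (ℂ × ℂ)) (hU : IsOpen U) (q₀ : ℂ × ℂ) (hq₀ : q₀ ∈ U)
    (S A B : ℂ × ℂ → ℂ)
    (hS : AnalyticOnNhd ℂ S U) (hA : AnalyticOnNhd ℂ A U) (hB : AnalyticOnNhd ℂ B U)
    (hreg : ∃ᶠ q in 𝓝 q₀, IsRegularPoint (solutionWeb S A B) q)
    (wx wy : ℂ) (hw : wx ≠ wy)
    (hX : IsInfinitesimalSymmetry (solutionWeb S A B) U (weightedField wx wy))
    (hPDE : HydrodynamicSystem U S A B) :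
    ∃ (M : Set (Fin 3 → ℂ)) (F : FrobeniusStructure M)
      (U' : Set (ℂ × ℂ)) (σ : ℂ × ℂ → Fin 3 → ℂ),
      (∀ p ∈ M, F.metric p (F.unit p) (F.unit p) = 0) ∧
      F.IsMassive ∧
      IsOpen U' ∧ q₀ ∈ U' ∧ U' ⊆ U ∧
      F.IsTransverseSurface U' σ ∧
      F.IsBookletWeb U' σ (solutionWeb S A B) ∧
      (∀ q ∈ U', F.euler (σ q) - fderiv ℂ σ q (weightedField wx wy q)
        ∈ Submodule.span ℂ {F.unit (σ q)}) := by
  simp only [isRegularPoint_solutionWeb_iff_disc] at hreg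
  -- A ball is connected, so by the identity theorem the regular points are dense in all of it.
  obtain ⟨r, hr, hrU⟩ := Metric.isOpen_iff.1 hU q₀ hq₀
  set U' := Metric.ball q₀ r
  have hU' : IsOpen U' := Metric.isOpen_ball
  have hS' := hS.mono hrU
  have hA' := hA.mono hrU
  have hB' := hB.mono hrU
  have hdense : ∀ q ∈ U', ∃ᶠ x in 𝓝 q, cubicDisc (S x) (A x) (B x) ≠ 0 := fun q hq =>
    frequently_cubicDisc_ne_zero (convex_ball q₀ r).isPreconnected hS' hA' hB'
      (Metric.ball_mem_nhds q₀ hr) hreg hq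
  have hwt := fun q (hq : q ∈ U') => coeffs_weighted hU hS hA hB hX (hrU hq) (hdense q hq)
  let F := cubicFrobeniusStructure hU' hS' hA' hB' (fun q hq => hPDE q (hrU hq)) wx wy hwt
  -- An idempotent frame of `F` at `t` is by definition a cubic frame for the coefficients at
  -- `planeProj t`.
  have hss : ∀ t, F.IsSemisimpleAt t ↔
      cubicDisc (S (planeProj t)) (A (planeProj t)) (B (planeProj t)) ≠ 0 :=
    fun t => isSemisimple_iff_disc
  have hσ : ∀ q, fderiv ℂ planeSection q = planeSection := fun q => planeSection.fderiv
  have hbook : ∀ q, cubicDisc (S q) (A q) (B q) ≠ 0 →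
      F.bookletDirections planeSection q = solutionWeb S A B q := by
    intro q hq
    have h := booklet_eq_roots hq
    unfold FrobeniusStructure.bookletDirections
    rw [hσ]
    exact h
  refine ⟨_, F, U', planeSection, ?_, ?_, hU', Metric.mem_ball_self hr, hrU, ?_, ?_, ?_⟩
  · intro p _
    change antidiagForm ![1, 0, 0] ![1, 0, 0] = 0
    simp
  · refine ⟨planeProj ⁻¹' {q | q ∈ U' ∧ cubicDisc (S q) (A q) (B q) ≠ 0}, fun t ht => ht.1, ?_,
      ?_, fun t ht => (hss t).2 ht.2⟩
    · exact ((cubicDisc_analyticOnNhd hS' hA' hB').continuousOn.isOpen_inter_preimage hU'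
        isOpen_compl_singleton).preimage planeProj.continuous
    · obtain ⟨q, hq, hqU⟩ := (hreg.and_eventually (Metric.ball_mem_nhds q₀ hr)).exists
      refine ⟨planeSection q, ?_⟩
      rw [Set.mem_preimage, planeProj_planeSection]
      exact ⟨hqU, hq⟩
  · refine ⟨planeSection.analyticOnNhd _, fun q hq => ?_, planeSection_injective.injOn, ?_, ?_⟩
    · rw [Set.mem_preimage, planeProj_planeSection]
      exact hq
    · intro q _
      rw [hσ]
      exact planeSection_injective
    · rintro q _ ⟨v, hv⟩
      rw [hσ] at hv
      have h0 := congrFun hv 0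
      rw [planeSection_apply] at h0
      exact zero_ne_one h0
  · intro q hq
    rw [isRegularPoint_solutionWeb_iff_disc, hss, planeProj_planeSection]
    refine ⟨Iff.rfl, hbook q, fun v hv => ?_⟩
    rw [span_mem_solutionWeb_iff_mem_closure hU' hS'.continuousOn hA'.continuousOn
      hB'.continuousOn hq (hdense q hq) hv]
    have : {z : (ℂ × ℂ) × (ℂ × ℂ) | z.1 ∈ U' ∧ z.2 ≠ 0 ∧
          cubicDisc (S z.1) (A z.1) (B z.1) ≠ 0 ∧
          Submodule.span ℂ {z.2} ∈ solutionWeb S A B z.1}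
        = {z | z.1 ∈ U' ∧ z.2 ≠ 0 ∧
          Submodule.span ℂ {z.2} ∈ F.bookletDirections planeSection z.1} := by
      ext z
      refine and_congr_right fun _ => and_congr_right fun _ => ⟨fun h => ?_, fun h => ?_⟩
      · rw [hbook _ h.1]
        exact h.2
      · have hd : cubicDisc (S z.1) (A z.1) (B z.1) ≠ 0 := by
          obtain ⟨ε, hε, _⟩ := h
          have := (hss (planeSection z.1)).1 ⟨ε, hε⟩
          rwa [planeProj_planeSection] at this
        rw [hbook _ hd] at h
        exact ⟨hd, h⟩
    rw [this]
  · intro q _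
    -- On the slice `t₀ = 0` the Euler field is tangent to the surface, so the difference is zero.
    have : F.euler (planeSection q) = fderiv ℂ planeSection q (weightedField wx wy q) := by
      change linearEuler ![2 * wy - wx, wy, wx] (planeSection q) = _
      rw [hσ]
      simp [weightedField]
    rw [this, sub_self]
    exact zero_mem _
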